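/- Let $m\ge 2$ be even and $n\ge 1$ an integer, and let $S_{mn}$ be the group of permutations of $\{1,\dots,mn\}$ with identity $e$. For $g,h\in S_{mn}$ let $d(g,h)$ be the Cayley distance, i.e. the minimal number of transpositions whose product takes $g$ to $h$. Define, in cycle notation, $$g_B=(1\,\dots\,m)(m+1\,\dots\,2m)\cdots(nm-m+1\,\dots\,nm),$$ $$g_A=(\tfrac m2+1\,\dots\,\tfrac{3m}2)(\tfrac{3m}2+1\,\dots\,\tfrac{5m}2)\cdots(nm-\tfrac m2+1\,\dots\,\tfrac m2),$$ $$X=(1\,\dots\,\tfrac m2)(\tfrac m2+1\,\dots\,m)\cdots(nm-\tfrac m2+1\,\dots\,nm),$$ where each cycle runs through consecutive integers (taken modulo $mn$ in the last cycle of $g_A$), so that $g_A$ and $g_B$ have $n$ cycles of length $m$ and $X$ has $2n$ cycles of length $\tfrac m2$. Then for all real $x_A,x_B>0$ the function $f(g)=x_A\,d(g,g_A)+x_B\,d(g,g_B)+d(g,e)$ on $S_{mn}$ satisfies $$\min_{g\in S_{mn}} f(g)=\min_{g\in\{e,X,g_A,g_B\}} f(g).$$ Moreover, if $n\ge 2$,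 then $P(X)=P(g_A)\wedge P(g_B)$, where $P(g)$ is the partition of $\{1,\dots,mn\}$ into the cycles of $g$ (fixed points included) and $\wedge$ is the coarsest common refinement of partitions. -/

import Mathlib

namespace ReflectedEntropy

/-- The Cayley distance on the permutation group of `α`: the minimal number of transpositions
whose product takes `g` to `h`. -/
noncomputable def cayleyDist {α : Type*} [DecidableEq α] (g h : Equiv.Perm α) : ℕ :=
  sInf {k : ℕ | ∃ l : List (Equiv.Perm α),
    l.length = k ∧ (∀ σ ∈ l, σ.IsSwap) ∧ l.prod * g = h}

/-- On a finite type the minimum in `cayleyDist` is over a nonempty set, hence is attained. -/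
theorem exists_list_length_eq_cayleyDist {α : Type*} [DecidableEq α] [Finite α]
    (g h : Equiv.Perm α) :
    ∃ l : List (Equiv.Perm α),
      l.length = cayleyDist g h ∧ (∀ σ ∈ l, σ.IsSwap) ∧ l.prod * g = h := by
  have hne : {k : ℕ | ∃ l : List (Equiv.Perm α),
      l.length = k ∧ (∀ σ ∈ l, σ.IsSwap) ∧ l.prod * g = h}.Nonempty := by
    have := Fintype.ofFinite α
    obtain ⟨l, hl, hs⟩ := (Equiv.Perm.truncSwapFactors (h * g⁻¹)).out
    exact ⟨l.length, l, rfl, hs, by rw [hl]; simp⟩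
  exact Nat.sInf_mem hne

/-- The cycle `(s, s + 1, …, s + L - 1)` on `{0, …, N - 1}`, the entries being read modulo `N`. -/
def intervalCycle (N : ℕ) [NeZero N] (s L : ℕ) : Equiv.Perm (Fin N) :=
  ((List.range L).map fun i => Fin.ofNat N (s + i)).formPerm

/-- `g_B = (1 … m)(m+1 … 2m) … (nm-m+1 … nm)`, with the labels `1, …, mn` shifted down by one. -/
def gB (m n : ℕ) [NeZero m] [NeZero n] : Equiv.Perm (Fin (m * n)) :=
  ((List.range n).map fun j => intervalCycle (m * n) (j * m) m).prod

/-- `g_A = (m/2+1 … 3m/2)(3m/2+1 … 5m/2) … (nm-m/2+1 … m/2)`, labels shifted down by one;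
the last cycle wraps around. -/
def gA (m n : ℕ) [NeZero m] [NeZero n] : Equiv.Perm (Fin (m * n)) :=
  ((List.range n).map fun j => intervalCycle (m * n) (j * m + m / 2) m).prod

/-- `X = (1 … m/2)(m/2+1 … m) … (nm-m/2+1 … nm)`, a product of `2n` cycles of length `m/2`,
labels shifted down by one. -/
def gX (m n : ℕ) [NeZero m] [NeZero n] : Equiv.Perm (Fin (m * n)) :=
  ((List.range (2 * n)).map fun j => intervalCycle (m * n) (j * (m / 2)) (m / 2)).prod

/-- The free energy `f(g) = x_A d(g, g_A) + x_B d(g, g_B) + d(g, e)`. -/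
noncomputable def freeEnergy (m n : ℕ) [NeZero m] [NeZero n] (xA xB : ℝ)
    (g : Equiv.Perm (Fin (m * n))) : ℝ :=
  xA * cayleyDist g (gA m n) + xB * cayleyDist g (gB m n) + cayleyDist g 1

/-- The partition `P(g)` into the orbits (cycles, fixed points included) of `g`. Partitions are
ordered by refinement, so `⊓` is the coarsest common refinement. -/
def cyclePartition {α : Type*} (g : Equiv.Perm α) : Setoid α :=
  Equiv.Perm.SameCycle.setoid g

end ReflectedEntropy

namespace ReflectedEntropy

/-! ### Cayley metric: triangle inequality, symmetry, parity, invariant colourings. -/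

section CayleyDist

variable {α : Type*} [DecidableEq α]

/-! Only the distances `a = d(g, g_A)`, `b = d(g, g_B)`, `c = d(g, e)` matter. Put `K = mn - n =
d(g_A, e) = d(g_B, e)`. For `n ≥ 2` every `g` satisfies `a + c ≥ K`, `b + c ≥ K`, `a + b ≥ 2n - 2`
and `n(a + b) + 2c ≥ 2n(n - 1) + 2K`. For positive weights, minimising `x a + y b + c` under these
constraints and nonnegativity is a linear programme with candidate optima `(K, K, 0)`, `(n, n, K -
n)`, `(0, 2n - 2, K)`, `(2n - 2, 0, K)` (`exists_vertex_le`). The permutations `e, X, g_A, g_B` have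
distances at most these, so upper bounds suffice for them.

The last constraint is the combinatorial core (`le_cayleyDist_add_of_shift`). By parity, either `a +
b ≥ 2n`, and adding `a + c ≥ K` and `b + c ≥ K` gives it, or `a + b = 2n - 2` and `g` lies on a
geodesic from `g_A` to `g_B`. In that case a colouring argument (`collapse_eq_of_cayleyDist_add_le`)
makes `g` agree with `g_A` up to permuting the even, and separately the odd, multiples of `m/2`;
every cycle of `g` then meets one of the `n` multiples of `m`, so `c ≥ K`
(`card_le_of_collapse_eq`). For `n = 1`, `g_A = g_B` and two triangle inequalities suffice.

The statement on partitions is arithmetic of block indices (`half_block_eq_iff`). -/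

theorem cayleyDist_le_length {g h : Equiv.Perm α} {l : List (Equiv.Perm α)}
    (hl : ∀ σ ∈ l, σ.IsSwap) (hg : l.prod * g = h) : cayleyDist g h ≤ l.length :=
  Nat.sInf_le ⟨l, rfl, hl, hg⟩

theorem cayleyDist_self (g : Equiv.Perm α) : cayleyDist g g = 0 :=
  Nat.le_zero.mp (cayleyDist_le_length (l := []) (by simp) (by simp))

theorem cayleyDist_swap_mul_le (g : Equiv.Perm α) (a b : α) :
    cayleyDist g (Equiv.swap a b * g) ≤ 1 := by
  by_cases hab : a = b
  · subst hab
    have : Equiv.swap a a * g = g := by ext; simp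
    rw [this, cayleyDist_self]
    exact Nat.zero_le _
  · exact cayleyDist_le_length (l := [Equiv.swap a b]) (by simpa using ⟨a, b, hab, rfl⟩) (by simp)

theorem cayleyDist_mul_swap_le (g : Equiv.Perm α) (a b : α) :
    cayleyDist g (g * Equiv.swap a b) ≤ 1 := by
  rw [Equiv.mul_swap_eq_swap_mul]
  exact cayleyDist_swap_mul_le _ _ _

theorem cayleyDist_mul_right_le [Finite α] (g h k : Equiv.Perm α) :
    cayleyDist (g * k) (h * k) ≤ cayleyDist g h := by
  obtain ⟨l, hlen, hl, hp⟩ := exists_list_length_eq_cayleyDist g h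
  rw [← hlen]
  exact cayleyDist_le_length hl (by rw [← mul_assoc, hp])

theorem cayleyDist_triangle [Finite α] (g h k : Equiv.Perm α) :
    cayleyDist g k ≤ cayleyDist g h + cayleyDist h k := by
  obtain ⟨l, hlen, hl, hp⟩ := exists_list_length_eq_cayleyDist g h
  obtain ⟨l', hlen', hl', hp'⟩ := exists_list_length_eq_cayleyDist h k
  rw [← hlen, ← hlen', add_comm, ← List.length_append]
  refine cayleyDist_le_length (fun σ hσ => ?_) ?_
  · exact (List.mem_append.mp hσ).elim (hl' σ) (hl σ)
  · rw [List.prod_append, mul_assoc, hp, hp']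

theorem inv_prod_eq_prod_reverse {l : List (Equiv.Perm α)} (hl : ∀ σ ∈ l, σ.IsSwap) :
    l.prod⁻¹ = l.reverse.prod := by
  induction l with
  | nil => simp
  | cons σ l ih =>
    obtain ⟨a, b, -, hab⟩ := hl σ (by simp)
    rw [List.prod_cons, mul_inv_rev, ih fun τ hτ => hl τ (by simp [hτ]), List.reverse_cons,
      List.prod_append, hab]
    simp

theorem cayleyDist_comm [Finite α] (g h : Equiv.Perm α) : cayleyDist g h = cayleyDist h g := by
  have key : ∀ g h : Equiv.Perm α, cayleyDist g h ≤ cayleyDist h g := by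
    intro g h
    obtain ⟨l, hlen, hl, hp⟩ := exists_list_length_eq_cayleyDist h g
    rw [← hlen, ← List.length_reverse]
    refine cayleyDist_le_length (fun σ hσ => hl σ (List.mem_reverse.mp hσ)) ?_
    rw [← inv_prod_eq_prod_reverse hl, ← hp]
    simp
  exact le_antisymm (key g h) (key h g)

theorem sign_eq_neg_one_pow_cayleyDist [Fintype α] (g h : Equiv.Perm α) :
    Equiv.Perm.sign h = (-1) ^ cayleyDist g h * Equiv.Perm.sign g := by
  obtain ⟨l, hlen, hl, hp⟩ := exists_list_length_eq_cayleyDist g h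
  rw [← hlen, ← Equiv.Perm.sign_prod_list_swap hl, ← hp, map_mul]

/-- Signs multiply along the triangle. This excludes the value `a + b = 2n - 1` between the two
cases of the main dichotomy. -/
theorem even_cayleyDist_add_add [Finite α] (g h k : Equiv.Perm α) :
    Even (cayleyDist g h + cayleyDist h k + cayleyDist g k) := by
  have := Fintype.ofFinite α
  have h1 := sign_eq_neg_one_pow_cayleyDist g h
  have h2 := sign_eq_neg_one_pow_cayleyDist h k
  have h3 := sign_eq_neg_one_pow_cayleyDist g k
  rw [h1, h3, ← mul_assoc] at h2
  have h4 := mul_right_cancel h2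
  rw [← neg_one_pow_eq_one_iff_even (R := ℤˣ) (by decide), pow_add, pow_add, h4,
    mul_comm ((-1 : ℤˣ) ^ cayleyDist g h), Int.units_mul_self]

/-- A colouring that is invariant under a list of transpositions can be chosen with at least
`card α - length` colours. -/
theorem exists_invariant_colouring [Fintype α] (l : List (Equiv.Perm α))
    (hl : ∀ σ ∈ l, σ.IsSwap) :
    ∃ φ : α → α, (∀ σ ∈ l, ∀ x, φ (σ x) = φ x) ∧
      Fintype.card α ≤ (Finset.univ.image φ).card + l.length := by
  induction l with
  | nil => exact ⟨id, by simp, by simp⟩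
  | cons σ l ih =>
    obtain ⟨φ, hφ, hc⟩ := ih fun τ hτ => hl τ (by simp [hτ])
    obtain ⟨a, b, -, rfl⟩ := hl σ (by simp)
    -- Merging the colour of `b` into that of `a` makes the new transposition harmless and loses at
    -- most one colour.
    refine ⟨fun x => if φ x = φ b then φ a else φ x, ?_, ?_⟩
    · intro τ hτ x
      rcases List.mem_cons.mp hτ with rfl | hτ
      · rcases eq_or_ne x a with rfl | hxa
        · simp
        rcases eq_or_ne x b with rfl | hxb
        · simp
        · rw [Equiv.swap_apply_of_ne_of_ne hxa hxb]
      · simp only [hφ τ hτ x]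
    · have hsub : (Finset.univ.image φ).erase (φ b) ⊆
          Finset.univ.image fun x => if φ x = φ b then φ a else φ x := by
        intro y hy
        obtain ⟨hyb, hy⟩ := Finset.mem_erase.mp hy
        obtain ⟨x, -, rfl⟩ := Finset.mem_image.mp hy
        exact Finset.mem_image.mpr ⟨x, Finset.mem_univ _, if_neg hyb⟩
      have h1 := Finset.card_le_card hsub
      have h2 := Finset.pred_card_le_card_erase (s := Finset.univ.image φ) (a := φ b)
      rw [List.length_cons]
      omega

end CayleyDist

/-! ### Bounding the distance to the identity by cycle counts and supports. -/

theorem apply_prod_eq {α β : Type*} {φ : α → β} {l : List (Equiv.Perm α)}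
    (hφ : ∀ σ ∈ l, ∀ x, φ (σ x) = φ x) (x : α) : φ (l.prod x) = φ x := by
  induction l with
  | nil => simp
  | cons σ l ih =>
    rw [List.prod_cons, Equiv.Perm.mul_apply, hφ σ (by simp), ih fun τ hτ => hφ τ (by simp [hτ])]

theorem eq_of_sameCycle {α β : Type*} [Finite α] {g : Equiv.Perm α} {φ : α → β}
    (hφ : ∀ x, φ (g x) = φ x) {x y : α} (h : g.SameCycle x y) : φ x = φ y := by
  obtain ⟨i, rfl⟩ := h.exists_nat_pow_eq
  have : ∀ i : ℕ, φ ((g ^ i) x) = φ x := by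
    intro i
    induction i with
    | zero => simp
    | succ i ih => rw [pow_succ', Equiv.Perm.mul_apply, hφ, ih]
  exact (this i).symm

/-- A colouring invariant under a factorisation of `g⁻¹` is constant on cycles of `g`, so its
colours all occur on a set meeting every cycle. This is the lower bound "degree minus number of
cycles". -/
theorem card_le_card_add_cayleyDist_one {α : Type*} [DecidableEq α] [Fintype α]
    (g : Equiv.Perm α) (T : Finset α) (hT : ∀ x, ∃ t ∈ T, g.SameCycle x t) :
    Fintype.card α ≤ T.card + cayleyDist g 1 := by
  obtain ⟨l, hlen, hl, hp⟩ := exists_list_length_eq_cayleyDist g 1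
  obtain ⟨φ, hφ, hc⟩ := exists_invariant_colouring l hl
  have hg : ∀ x, φ (g x) = φ x := by
    intro x
    rw [← apply_prod_eq hφ (g x), ← Equiv.Perm.mul_apply, hp, Equiv.Perm.one_apply]
  have hsub : Finset.univ.image φ ⊆ T.image φ := by
    intro y hy
    obtain ⟨x, -, rfl⟩ := Finset.mem_image.mp hy
    obtain ⟨t, ht, hxt⟩ := hT x
    exact Finset.mem_image.mpr ⟨t, ht, (eq_of_sameCycle hg hxt).symm⟩
  have := (Finset.card_le_card hsub).trans Finset.card_image_le
  omega

/-- Composing with the transposition of `a` and `π a` fixes `a` and shrinks the support by a point;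
a one-point support costs nothing. -/
theorem cayleyDist_one_add_one_le_card {α : Type*} [DecidableEq α] [Finite α] (T : Finset α)
    (hT : T.Nonempty) : ∀ π : Equiv.Perm α, (∀ x ∉ T, π x = x) →
      cayleyDist 1 π + 1 ≤ T.card := by
  induction hT using Finset.Nonempty.cons_induction with
  | singleton a =>
    intro π hπ
    have : π = 1 := by
      ext x
      by_cases hx : x = a
      · subst hx
        by_contra hne
        exact hne (π.injective (hπ _ (by simpa using hne)))
      · exact hπ x (by simpa using hx)
    simp [this, cayleyDist_self]
  | cons a T ha hT ih =>
    intro π hπ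
    have h1 := ih (Equiv.swap a (π a) * π) fun x hx => by
      rw [Equiv.Perm.mul_apply]
      rcases eq_or_ne x a with rfl | hxa
      · simp
      · have hx' := hπ x (by simp [hxa, hx])
        rw [hx', Equiv.swap_apply_of_ne_of_ne hxa]
        intro h
        exact hxa (π.injective (by rw [hx', h]))
    have h2 := cayleyDist_triangle 1 (Equiv.swap a (π a) * π) π
    have h3 := cayleyDist_swap_mul_le π a (π a)
    rw [cayleyDist_comm] at h3
    rw [Finset.card_cons]
    omega

/-- An invariant `T` saves a second transposition: once `T` is peeled down to one point, that point
is fixed and only `S` remains. -/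
theorem cayleyDist_one_add_two_le_card {α : Type*} [DecidableEq α] [Finite α] (T S : Finset α)
    (hT : T.Nonempty) (hS : S.Nonempty) : ∀ π : Equiv.Perm α, (∀ x ∈ T, π x ∈ T) →
      (∀ x ∉ T, x ∉ S → π x = x) → cayleyDist 1 π + 2 ≤ T.card + S.card := by
  induction hT using Finset.Nonempty.cons_induction with
  | singleton a =>
    intro π hπ hfix
    have := cayleyDist_one_add_one_le_card S hS π fun x hx => by
      by_cases hxa : x = a
      · subst hxa
        simpa using hπ x (by simp)
      · exact hfix x (by simpa using hxa) hx
    rw [Finset.card_singleton]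
    omega
  | cons a T ha hT ih =>
    intro π hπ hfix
    have h1 := ih (Equiv.swap a (π a) * π) (fun x hx => by
      have hxa : x ≠ a := fun h => ha (h ▸ hx)
      have hx' := hπ x (by simp [hx])
      have ha' := hπ a (by simp)
      rw [Equiv.Perm.mul_apply]
      by_cases h : π x = a
      · rw [h, Equiv.swap_apply_left]
        rw [Finset.mem_cons] at ha'
        rcases ha' with ha' | ha'
        · exact absurd (π.injective (h.trans ha'.symm)) hxa
        · exact ha'
      · rw [Equiv.swap_apply_of_ne_of_ne h fun h => hxa (π.injective h)]
        exact (Finset.mem_cons.mp hx').resolve_left h) fun x hxT hxS => by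
      rw [Equiv.Perm.mul_apply]
      rcases eq_or_ne x a with rfl | hxa
      · simp
      · have hx' := hfix x (by simp [hxa, hxT]) hxS
        rw [hx', Equiv.swap_apply_of_ne_of_ne hxa]
        intro h
        exact hxa (π.injective (by rw [hx', h]))
    have h2 := cayleyDist_triangle 1 (Equiv.swap a (π a) * π) π
    have h3 := cayleyDist_swap_mul_le π a (π a)
    rw [cayleyDist_comm] at h3
    rw [Finset.card_cons]
    omega

/-! ### The linear programme and its dual certificates. -/

/-- Dual certificate at the vertex of `g_B` for small `x`: with `r = x / n`, the weights are `1 -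
2r` on `hbc`, `r` on `habc` and `y - rn - (1 - 2r)` on `0 ≤ b`. -/
theorem vertex_le_of_lt {n K a b c x y : ℝ} (hn : 2 ≤ n) (hx : 0 < x) (hb : 0 ≤ b)
    (hbc : K ≤ b + c) (habc : 2 * n * (n - 1) + 2 * K ≤ n * (a + b) + 2 * c)
    (hxy : x * (2 * n - 2) < n * (x + y - 1)) (hxn : x ≤ n / 2) :
    x * (2 * n - 2) + K ≤ x * a + y * b + c := by
  obtain ⟨r, rfl⟩ : ∃ r, x = r * n := ⟨x / n, by field_simp⟩
  have hr : 0 < r := pos_of_mul_pos_left hx (by linarith)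
  have hr2 : r ≤ 1 / 2 := by
    by_contra! h
    nlinarith
  have ht : r * (2 * n - 2) < r * n + y - 1 := by
    by_contra! h
    nlinarith
  have h1 := mul_le_mul_of_nonneg_left hbc (by linarith : 0 ≤ 1 - 2 * r)
  have h2 := mul_le_mul_of_nonneg_left habc hr.le
  have h3 := mul_nonneg (by linarith : 0 ≤ y - r * n - (1 - 2 * r)) hb
  linarith

/-- Dual certificate at the same vertex for large `x`: weights `x - n/2` on `hab`, `1/2` on `habc`
and `y - x` on `0 ≤ b`. -/
theorem vertex_le_of_le {n K a b c x y : ℝ} (hb : 0 ≤ b)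
    (hab : 2 * n - 2 ≤ a + b) (habc : 2 * n * (n - 1) + 2 * K ≤ n * (a + b) + 2 * c)
    (hxy : x ≤ y) (hxn : n / 2 ≤ x) :
    x * (2 * n - 2) + K ≤ x * a + y * b + c := by
  have h1 := mul_le_mul_of_nonneg_left hab (by linarith : 0 ≤ x - n / 2)
  have h2 := mul_nonneg (by linarith : 0 ≤ y - x) hb
  linarith

/-- Four-vertex linear programme: the free energy at distances `(a, b, c)` is at least its value
at one of the vertices. -/
theorem exists_vertex_le {n K a b c x y : ℝ} (hn : 2 ≤ n) (hx : 0 < x) (hy : 0 < y)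
    (ha : 0 ≤ a) (hb : 0 ≤ b) (hc : 0 ≤ c) (hac : K ≤ a + c) (hbc : K ≤ b + c)
    (hab : 2 * n - 2 ≤ a + b) (habc : 2 * n * (n - 1) + 2 * K ≤ n * (a + b) + 2 * c) :
    (x + y) * K ≤ x * a + y * b + c ∨ (x + y) * n + (K - n) ≤ x * a + y * b + c ∨
      y * (2 * n - 2) + K ≤ x * a + y * b + c ∨ x * (2 * n - 2) + K ≤ x * a + y * b + c := by
  have hba : 2 * n - 2 ≤ b + a := by linarith
  have hbac : 2 * n * (n - 1) + 2 * K ≤ n * (b + a) + 2 * c := by linarith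
  -- Stated for free variables so that it also applies with the roles of `g_A` and `g_B` exchanged.
  have key : ∀ {a b x y : ℝ}, 0 < x → 0 < y → 0 ≤ a → 0 ≤ b → K ≤ b + c → 2 * n - 2 ≤ a + b →
      2 * n - 2 ≤ b + a → 2 * n * (n - 1) + 2 * K ≤ n * (a + b) + 2 * c →
      2 * n * (n - 1) + 2 * K ≤ n * (b + a) + 2 * c → x * (2 * n - 2) < n * (x + y - 1) →
      y * (2 * n - 2) + K ≤ x * a + y * b + c ∨ x * (2 * n - 2) + K ≤ x * a + y * b + c := by
    intro a b x y hx hy ha hb hbc hab hba habc hbac hlt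
    rcases le_total x (n / 2) with hxn | hxn
    · exact Or.inr (vertex_le_of_lt hn hx hb hbc habc hlt hxn)
    rcases le_total x y with hxy | hxy
    · exact Or.inr (vertex_le_of_le hb hab habc hxy hxn)
    rcases le_total (n / 2) y with hyn | hyn
    · left
      linarith [vertex_le_of_le ha hba hbac hxy hyn]
    · exfalso
      nlinarith [mul_nonneg (by linarith : 0 ≤ n - 2) (by linarith : 0 ≤ x - n / 2)]
  rcases le_total (x + y) 1 with hxy | hxy
  · left
    have h1 := mul_le_mul_of_nonneg_left hac hx.le
    have h2 := mul_le_mul_of_nonneg_left hbc hy.le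
    have h3 := mul_nonneg (by linarith : 0 ≤ 1 - x - y) hc
    linarith
  rcases lt_or_ge (x * (2 * n - 2)) (n * (x + y - 1)) with hp | hp
  · exact Or.inr (Or.inr (key hx hy ha hb hbc hab hba habc hbac hp))
  rcases lt_or_ge (y * (2 * n - 2)) (n * (y + x - 1)) with hq | hq
  · have := key hy hx hb ha hac hba hab hbac habc hq
    right; right
    rw [add_comm (x * a)]
    exact this.symm
  right; left
  -- Certificate at the vertex of `X`: weights `x - rn`, `y - rn`, `r` on `hac`, `hbc`, `habc`.
  -- Matching the coefficient of `c` fixes `r`, and `hp`, `hq` make the first two weights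
  -- nonnegative.
  obtain ⟨r, hr⟩ : ∃ r, r * (2 * n - 2) = x + y - 1 :=
    ⟨(x + y - 1) / (2 * n - 2), div_mul_cancel₀ _ (by linarith)⟩
  have hr0 : 0 ≤ r := by
    by_contra! h
    nlinarith
  have hp' : r * n ≤ x := by
    rw [← hr] at hp
    by_contra! h
    nlinarith
  have hq' : r * n ≤ y := by
    rw [add_comm y, ← hr] at hq
    by_contra! h
    nlinarith
  have h1 := mul_le_mul_of_nonneg_left hac (by linarith : 0 ≤ x - r * n)
  have h2 := mul_le_mul_of_nonneg_left hbc (by linarith : 0 ≤ y - r * n)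
  have h3 := mul_le_mul_of_nonneg_left habc hr0
  have hy' : y = r * (2 * n - 2) + 1 - x := by linarith
  subst hy'
  linarith


/-! ### Splitting list cycles and evaluating products of disjoint cycles. -/

theorem formPerm_append_cons {α : Type*} [DecidableEq α] (l l' : List α) (a b : α) :
    ((l ++ [a]) ++ b :: l').formPerm =
      (l ++ [a]).formPerm * Equiv.swap a b * (b :: l').formPerm := by
  induction l with
  | nil => simp
  | cons x l ih =>
    cases l with
    | nil => simp [mul_assoc]
    | cons y l => simp only [List.cons_append, List.formPerm_cons_cons, mul_assoc] at ih ⊢; rw [ih]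

theorem cayleyDist_formPerm_one_add_one_le {α : Type*} [DecidableEq α] [Finite α] (l : List α)
    (hl : l ≠ []) : cayleyDist l.formPerm 1 + 1 ≤ l.length := by
  induction l with
  | nil => exact absurd rfl hl
  | cons x l ih =>
    cases l with
    | nil => simp [cayleyDist_self]
    | cons y l =>
      have h1 := ih (by simp)
      have h2 := cayleyDist_triangle (x :: y :: l).formPerm (y :: l).formPerm 1
      have h3 := cayleyDist_swap_mul_le (y :: l).formPerm x y
      rw [cayleyDist_comm, ← List.formPerm_cons_cons] at h3
      rw [List.length_cons]
      omega

theorem cayleyDist_mul_swap_mul_le {α : Type*} [DecidableEq α] [Finite α]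
    (g h c c' : Equiv.Perm α) (a b : α) :
    cayleyDist (g * c * c') (h * (c * Equiv.swap a b * c')) ≤ cayleyDist g h + 1 := by
  have h1 := cayleyDist_mul_right_le (g * c) (h * c * Equiv.swap a b) c'
  have h2 := cayleyDist_triangle (g * c) (h * c) (h * c * Equiv.swap a b)
  have h3 := cayleyDist_mul_right_le g h c
  have h4 := cayleyDist_mul_swap_le (h * c) a b
  have e : h * (c * Equiv.swap a b * c') = h * c * Equiv.swap a b * c' := by group
  rw [e]
  omega

theorem prod_map_range_apply {α : Type*} {f : ℕ → Equiv.Perm α} {k j : ℕ} (hj : j < k) {x y : α}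
    (hxy : f j x = y) (hx : ∀ i < k, i ≠ j → f i x = x) (hy : ∀ i < k, i ≠ j → f i y = y) :
    ((List.range k).map f).prod x = y := by
  have hfix : ∀ {k : ℕ} {z : α}, (∀ i < k, f i z = z) → ((List.range k).map f).prod z = z := by
    intro k z h
    induction k with
    | zero => simp
    | succ k ih =>
      rw [List.range_succ, List.map_append, List.prod_append, Equiv.Perm.mul_apply]
      simp only [List.map_cons, List.map_nil, List.prod_singleton]
      rw [h k (by omega), ih fun i hi => h i (by omega)]
  induction k with
  | zero => omega
  | succ k ih =>
    rw [List.range_succ, List.map_append, List.prod_append, Equiv.Perm.mul_apply]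
    simp only [List.map_cons, List.map_nil, List.prod_singleton]
    rcases Nat.lt_succ_iff_lt_or_eq.mp hj with hj' | rfl
    · rw [hx k (by omega) (by omega)]
      exact ih hj' (fun i hi => hx i (by omega)) fun i hi => hy i (by omega)
    · rw [hxy]
      exact hfix fun i hi => hy i (by omega) (by omega)

/-! ### Products of consecutive interval cycles: action, cycles and distances. -/

section Blocks

variable {N : ℕ} [NeZero N]

theorem ofNat_eq_ofNat_iff {y z : ℕ} : Fin.ofNat N y = Fin.ofNat N z ↔ y ≡ z [MOD N] := by
  simp [Fin.ext_iff, Fin.ofNat, Nat.ModEq]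

theorem ofNat_val (x : Fin N) : Fin.ofNat N x.val = x := by
  ext; simp [Fin.ofNat, Nat.mod_eq_of_lt x.isLt]

theorem ofNat_add_mul (y j : ℕ) : Fin.ofNat N (y + j * N) = Fin.ofNat N y := by
  rw [ofNat_eq_ofNat_iff]; simp [Nat.ModEq]

/-- The product of `k` consecutive cycles of length `L` on `{0, …, N - 1}`, starting at `s`. -/
def blockCycles (N : ℕ) [NeZero N] (s L k : ℕ) : Equiv.Perm (Fin N) :=
  ((List.range k).map fun j => intervalCycle N (s + j * L) L).prod

theorem intervalCycle_apply {s L i : ℕ} (hL : L ≤ N) (hi : i < L) :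
    intervalCycle N s L (Fin.ofNat N (s + i)) = Fin.ofNat N (s + (i + 1) % L) := by
  have hnd : ((List.range L).map fun i => Fin.ofNat N (s + i)).Nodup := by
    refine List.Nodup.map_on (fun a ha b hb h => ?_) List.nodup_range
    rw [List.mem_range] at ha hb
    exact (Nat.ModEq.add_left_cancel' s (ofNat_eq_ofNat_iff.mp h)).eq_of_lt_of_lt
      (by omega) (by omega)
  have := List.formPerm_apply_getElem _ hnd i (by simpa using hi)
  simpa [intervalCycle] using this

theorem intervalCycle_apply_of_ne {s L : ℕ} {x : Fin N} (h : ∀ i < L, x ≠ Fin.ofNat N (s + i)) :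
    intervalCycle N s L x = x := by
  refine List.formPerm_apply_of_notMem fun hx => ?_
  obtain ⟨i, hi, rfl⟩ := List.mem_map.mp hx
  exact h i (List.mem_range.mp hi) rfl

theorem blockCycles_apply {s L k : ℕ} (hN : k * L = N) (j : ℕ) {i : ℕ} (hi : i < L) :
    blockCycles N s L k (Fin.ofNat N (s + j * L + i)) =
      Fin.ofNat N (s + j * L + (i + 1) % L) := by
  have hN0 := NeZero.pos N
  have hk : 0 < k := Nat.pos_of_mul_pos_right (hN ▸ hN0)
  have hLN : L ≤ N := hN ▸ Nat.le_mul_of_pos_left L hk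
  -- The block index is arbitrary; only its residue modulo `k` matters, and that residue names an
  -- actual factor.
  have hred : ∀ i, Fin.ofNat N (s + j * L + i) = Fin.ofNat N (s + (j % k) * L + i) := by
    intro i
    have e : s + j * L + i = s + (j % k) * L + i + (j / k) * N := by
      conv_lhs => rw [← Nat.mod_add_div j k]
      rw [← hN]
      ring
    rw [e, ofNat_add_mul]
  have hmod : (i + 1) % L < L := Nat.mod_lt _ (by omega)
  rw [hred, hred]
  have hother : ∀ r < L, ∀ p < k, p ≠ j % k →
      intervalCycle N (s + p * L) L (Fin.ofNat N (s + (j % k) * L + r)) =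
        Fin.ofNat N (s + (j % k) * L + r) := by
    intro r hr p hp hpj
    refine intervalCycle_apply_of_ne fun q hq h => hpj ?_
    have hlt : ∀ {p r : ℕ}, p < k → r < L → p * L + r < N := by
      intro p r hp hr
      calc p * L + r < (p + 1) * L := by linarith
        _ ≤ N := hN ▸ Nat.mul_le_mul_right L hp
    rw [ofNat_eq_ofNat_iff, add_assoc, add_assoc] at h
    have h' := (Nat.ModEq.add_left_cancel' s h).eq_of_lt_of_lt
      (hlt (Nat.mod_lt _ hk) hr) (hlt hp hq)
    have h1 : (j % k * L + r) / L = j % k := by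
      rw [mul_comm, Nat.mul_add_div (by omega), Nat.div_eq_of_lt hr, add_zero]
    have h2 : (p * L + q) / L = p := by
      rw [mul_comm, Nat.mul_add_div (by omega), Nat.div_eq_of_lt hq, add_zero]
    rw [← h1, h', h2]
  exact prod_map_range_apply (f := fun j => intervalCycle N (s + j * L) L) (Nat.mod_lt j hk)
    (intervalCycle_apply hLN hi) (hother i hi) (hother _ hmod)

theorem blockCycles_apply_of_lt {s L k : ℕ} (hN : k * L = N) (j : ℕ) {i : ℕ} (hi : i + 1 < L) :
    blockCycles N s L k (Fin.ofNat N (s + j * L + i)) = Fin.ofNat N (s + j * L + i + 1) := by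
  rw [blockCycles_apply hN j (by omega), Nat.mod_eq_of_lt hi, add_assoc _ i]

theorem blockCycles_apply_last {s L k : ℕ} (hN : k * L = N) (j : ℕ) {i : ℕ} (hi : i + 1 = L) :
    blockCycles N s L k (Fin.ofNat N (s + j * L + i)) = Fin.ofNat N (s + j * L) := by
  rw [blockCycles_apply hN j (by omega), hi, Nat.mod_self, add_zero]

theorem exists_ofNat_eq {s L : ℕ} (hsN : s ≤ N) (hL : 0 < L) (x : Fin N) :
    ∃ j i, i < L ∧ x = Fin.ofNat N (s + j * L + i) ∧ j = (x.val + (N - s)) % N / L := by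
  refine ⟨(x.val + (N - s)) % N / L, (x.val + (N - s)) % N % L, Nat.mod_lt _ hL, ?_, rfl⟩
  rw [add_assoc, Nat.div_add_mod']
  conv_lhs => rw [← ofNat_val x]
  rw [ofNat_eq_ofNat_iff]
  have h : s + (x.val + (N - s)) % N ≡ s + (x.val + (N - s)) [MOD N] :=
    Nat.ModEq.add_left s (Nat.mod_modEq _ _)
  refine Nat.ModEq.trans ?_ h.symm
  have : s + (x.val + (N - s)) = x.val + N := by omega
  rw [this]
  simp [Nat.ModEq]

theorem sameCycle_blockCycles_start {s L k : ℕ} (hN : k * L = N) (j : ℕ) {i : ℕ} (hi : i < L) :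
    (blockCycles N s L k).SameCycle (Fin.ofNat N (s + j * L)) (Fin.ofNat N (s + j * L + i)) := by
  induction i with
  | zero => exact Equiv.Perm.SameCycle.refl _ _
  | succ i ih =>
    rw [← add_assoc, ← blockCycles_apply_of_lt hN j hi]
    exact Equiv.Perm.sameCycle_apply_right.mpr (ih (by omega))

/-- Adding `N - s` undoes the offset modulo `N`, so the quotient by `L` is the index of the block
containing the point. -/
theorem sameCycle_blockCycles_iff {s L k : ℕ} (hN : k * L = N) (hsN : s ≤ N) {x y : Fin N} :
    (blockCycles N s L k).SameCycle x y ↔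
      (x.val + (N - s)) % N / L = (y.val + (N - s)) % N / L := by
  have hL : 0 < L := Nat.pos_of_mul_pos_left (hN ▸ NeZero.pos N)
  constructor
  · refine eq_of_sameCycle (φ := fun x : Fin N => (x.val + (N - s)) % N / L) fun x => ?_
    have hidx : ∀ j i, i < L →
        ((Fin.ofNat N (s + j * L + i)).val + (N - s)) % N / L = j % k := by
      intro j i hi
      have h1 : ((Fin.ofNat N (s + j * L + i)).val + (N - s)) % N = (j * L + i) % (k * L) := by
        rw [hN, Fin.ofNat, Nat.mod_add_mod]
        have : s + j * L + i + (N - s) = j * L + i + N := by omega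
        rw [this, Nat.add_mod_right]
      rw [h1, mul_comm k, Nat.mod_mul_right_div_self, mul_comm, Nat.mul_add_div hL,
        Nat.div_eq_of_lt hi, add_zero]
    obtain ⟨j, i, hi, rfl, -⟩ := exists_ofNat_eq hsN hL x
    simp only [blockCycles_apply hN j hi]
    rw [hidx j i hi, hidx j _ (Nat.mod_lt _ hL)]
  · intro h
    obtain ⟨j, i, hi, hx, hj⟩ := exists_ofNat_eq hsN hL x
    obtain ⟨j', i', hi', hy, hj'⟩ := exists_ofNat_eq hsN hL y
    have hjj : j = j' := by rw [hj, hj', h]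
    subst hjj
    rw [hx, hy]
    exact (sameCycle_blockCycles_start hN j hi).symm.trans (sameCycle_blockCycles_start hN j hi')

theorem blockCycles_succ (s L k : ℕ) :
    blockCycles N s L (k + 1) = blockCycles N s L k * intervalCycle N (s + k * L) L := by
  simp [blockCycles, List.range_succ]

theorem cayleyDist_intervalCycle_one_le (s L : ℕ) :
    cayleyDist (intervalCycle N s L) 1 ≤ L - 1 := by
  rcases Nat.eq_zero_or_pos L with rfl | hL
  · simp [intervalCycle, cayleyDist_self]
  have := cayleyDist_formPerm_one_add_one_le ((List.range L).map fun i => Fin.ofNat N (s + i))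
    (by simp; omega)
  rw [List.length_map, List.length_range] at this
  rw [intervalCycle]
  omega

theorem cayleyDist_blockCycles_one_le (s L k : ℕ) :
    cayleyDist (blockCycles N s L k) 1 ≤ k * (L - 1) := by
  induction k with
  | zero => simp [blockCycles, cayleyDist_self]
  | succ k ih =>
    rw [blockCycles_succ, Nat.succ_mul]
    refine (cayleyDist_triangle _ (intervalCycle N (s + k * L) L) _).trans (Nat.add_le_add ?_ ?_)
    · have := cayleyDist_mul_right_le (blockCycles N s L k) 1 (intervalCycle N (s + k * L) L)
      rw [one_mul] at this
      exact this.trans ih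
    · exact cayleyDist_intervalCycle_one_le _ _

theorem card_le_add_cayleyDist_blockCycles_one {s L k : ℕ} (hN : k * L = N) (hsN : s ≤ N) :
    N ≤ k + cayleyDist (blockCycles N s L k) 1 := by
  have hL : 0 < L := Nat.pos_of_mul_pos_left (hN ▸ NeZero.pos N)
  have := card_le_card_add_cayleyDist_one (blockCycles N s L k)
    ((Finset.range k).image fun j => Fin.ofNat N (s + j * L)) fun x => by
      obtain ⟨j, i, hi, hx, hj⟩ := exists_ofNat_eq hsN hL x
      refine ⟨Fin.ofNat N (s + j * L), Finset.mem_image.mpr ⟨j, ?_, rfl⟩, ?_⟩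
      · rw [Finset.mem_range, hj, Nat.div_lt_iff_lt_mul hL, hN]
        exact Nat.mod_lt _ (NeZero.pos N)
      · rw [hx]
        exact (sameCycle_blockCycles_start hN j hi).symm
  rw [Fintype.card_fin] at this
  exact this.trans (Nat.add_le_add_right (Finset.card_image_le.trans (by simp)) _)

/-- One transposition joins two adjacent half cycles; applied once per block, this bounds the
distance from `X` to `g_A` and to `g_B` by `n`. -/
theorem intervalCycle_two_mul (s : ℕ) {h : ℕ} (hh : 0 < h) :
    ∃ a b, intervalCycle N s (2 * h) =
      intervalCycle N s h * Equiv.swap a b * intervalCycle N (s + h) h := by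
  obtain ⟨p, rfl⟩ : ∃ p, h = p + 1 := ⟨h - 1, by omega⟩
  refine ⟨Fin.ofNat N (s + p), Fin.ofNat N (s + (p + 1) + 0), ?_⟩
  have h1 : (List.range (2 * (p + 1))).map (fun i => Fin.ofNat N (s + i)) =
      (List.range (p + 1)).map (fun i => Fin.ofNat N (s + i)) ++
        (List.range (p + 1)).map (fun i => Fin.ofNat N (s + (p + 1) + i)) := by
    rw [two_mul, List.range_add, List.map_append, List.map_map]
    simp [Function.comp_def, add_assoc]
  rw [intervalCycle, h1, intervalCycle, intervalCycle]
  rw [List.range_succ, List.map_append, ← List.range_succ, List.range_succ_eq_map,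
    List.map_cons, List.map_cons, List.map_nil]
  exact formPerm_append_cons _ _ _ _

theorem cayleyDist_blockCycles_two_mul_le (s n : ℕ) {h : ℕ} (hh : 0 < h) :
    cayleyDist (blockCycles N s h (2 * n)) (blockCycles N s (2 * h) n) ≤ n := by
  induction n with
  | zero => simp [blockCycles, cayleyDist_self]
  | succ n ih =>
    obtain ⟨a, b, hab⟩ := intervalCycle_two_mul (N := N) (s + n * (2 * h)) hh
    have e1 : s + 2 * n * h = s + n * (2 * h) := by ring
    have e2 : s + (2 * n + 1) * h = s + n * (2 * h) + h := by ring
    rw [Nat.mul_succ, blockCycles_succ, blockCycles_succ, blockCycles_succ, hab, e1, e2]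
    exact (cayleyDist_mul_swap_mul_le _ _ _ _ _ _).trans (Nat.add_le_add_right ih 1)

/-- With `L = m/2` this shows that halving the blocks of `g_A` gives the same `X` as halving those
of `g_B`. -/
theorem blockCycles_self_add {L k : ℕ} (hN : k * L = N) :
    blockCycles N L L k = blockCycles N 0 L k := by
  have hL : 0 < L := Nat.pos_of_mul_pos_left (hN ▸ NeZero.pos N)
  have hk : 0 < k := Nat.pos_of_mul_pos_right (hN ▸ NeZero.pos N)
  ext1 x
  obtain ⟨j, i, hi, rfl, -⟩ := exists_ofNat_eq (hN ▸ Nat.le_mul_of_pos_left L hk) hL x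
  rw [blockCycles_apply hN j hi]
  have e : ∀ i, L + j * L + i = 0 + (j + 1) * L + i := fun i => by ring
  rw [e, e, blockCycles_apply hN (j + 1) hi]

end Blocks


/-! ### Distance between the two block permutations, and the geodesics joining them. -/

section Geodesic

variable {N : ℕ} [NeZero N]

theorem dvd_val_ofNat_iff {d t : ℕ} (hd : d ∣ N) : d ∣ (Fin.ofNat N t).val ↔ d ∣ t :=
  Nat.dvd_mod_iff hd

theorem card_filter_dvd_val {d k : ℕ} (hN : k * d = N) :
    (Finset.univ.filter fun x : Fin N => d ∣ x.val).card = k := by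
  have hd : 0 < d := Nat.pos_of_mul_pos_left (hN ▸ NeZero.pos N)
  have : (Finset.univ.filter fun x : Fin N => d ∣ x.val) =
      (Finset.range k).image fun j => Fin.ofNat N (j * d) := by
    ext x
    simp only [Finset.mem_filter, Finset.mem_univ, true_and, Finset.mem_image, Finset.mem_range]
    constructor
    · rintro ⟨j, hj⟩
      refine ⟨j, ?_, by rw [mul_comm, ← hj, ofNat_val]⟩
      have hx := x.isLt
      rw [hj, ← hN, mul_comm] at hx
      exact Nat.lt_of_mul_lt_mul_right hx
    · rintro ⟨j, -, rfl⟩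
      rw [dvd_val_ofNat_iff ⟨k, by rw [← hN, mul_comm]⟩]
      exact dvd_mul_left _ _
  rw [this, Finset.card_image_of_injOn, Finset.card_range]
  intro i hi j hj hij
  have hlt : ∀ {i}, i ∈ (Finset.range k : Set ℕ) → i * d < N := fun {i} hi => by
    rw [← hN]
    exact Nat.mul_lt_mul_of_pos_right (by simpa using hi) hd
  exact Nat.eq_of_mul_eq_mul_right hd
    ((ofNat_eq_ofNat_iff.mp hij).eq_of_lt_of_lt (hlt hi) (hlt hj))

/-- The retraction collapsing the even multiples of `h` to `0` and the odd ones to `h`. -/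
def collapse (N h : ℕ) [NeZero N] (x : Fin N) : Fin N :=
  if 2 * h ∣ x.val then Fin.ofNat N 0 else if h ∣ x.val then Fin.ofNat N h else x

theorem not_two_mul_dvd_self {h : ℕ} (hh : 0 < h) : ¬ 2 * h ∣ h := fun hd => by
  have := Nat.le_of_dvd hh hd
  omega

variable {h n : ℕ}

theorem collapse_eq_iff (hN : n * (2 * h) = N) {x y : Fin N}
    (hxy : collapse N h x = collapse N h y) :
    (h ∣ x.val ↔ h ∣ y.val) ∧ (2 * h ∣ x.val ↔ 2 * h ∣ y.val) ∧ (¬ h ∣ y.val → x = y) := by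
  have hh : 0 < h := by
    have := Nat.pos_of_mul_pos_left (hN ▸ NeZero.pos N); omega
  have hdN : 2 * h ∣ N := ⟨n, by rw [← hN, mul_comm]⟩
  have hval : ∀ x : Fin N, (h ∣ (collapse N h x).val ↔ h ∣ x.val) ∧
      (2 * h ∣ (collapse N h x).val ↔ 2 * h ∣ x.val) := by
    intro x
    have h2 : 2 * h ∣ x.val → h ∣ x.val := (dvd_mul_left h 2).trans
    unfold collapse
    split_ifs with h0 h1
    · simp [h0, h2 h0, Fin.ofNat]
    · rw [dvd_val_ofNat_iff ((dvd_mul_left h 2).trans hdN), dvd_val_ofNat_iff hdN]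
      simp [h0, h1, not_two_mul_dvd_self hh]
    · simp
  refine ⟨by rw [← (hval x).1, hxy, (hval y).1], by rw [← (hval x).2, hxy, (hval y).2],
    fun hy => ?_⟩
  have hx : ¬ h ∣ x.val := by rwa [← (hval x).1, hxy, (hval y).1]
  have h2 : ∀ {z : Fin N}, ¬ h ∣ z.val → collapse N h z = z := fun {z} hz => by
    rw [collapse, if_neg fun h' => hz ((dvd_mul_left h 2).trans h'), if_neg hz]
  rwa [h2 hx, h2 hy] at hxy

/-- Where the block cycles offset by half a block differ from the unshifted ones. -/
theorem blockCycles_shift_cases (hN : n * (2 * h) = N) (z : Fin N) :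
    blockCycles N h (2 * h) n z = blockCycles N 0 (2 * h) n z ∨
    (∃ j, blockCycles N h (2 * h) n z = Fin.ofNat N ((j + 1) * (2 * h)) ∧
      blockCycles N 0 (2 * h) n z = Fin.ofNat N (j * (2 * h))) ∨
    ∃ j, blockCycles N h (2 * h) n z = Fin.ofNat N (h + j * (2 * h)) ∧
      blockCycles N 0 (2 * h) n z = Fin.ofNat N (h + (j + 1) * (2 * h)) := by
  have hL : 0 < 2 * h := Nat.pos_of_mul_pos_left (hN ▸ NeZero.pos N)
  have hn : 0 < n := Nat.pos_of_mul_pos_right (hN ▸ NeZero.pos N)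
  have hhN : h ≤ N := by
    have := Nat.le_mul_of_pos_left (2 * h) hn; omega
  obtain ⟨j, i, hi, rfl, -⟩ := exists_ofNat_eq hhN hL z
  have e1 : h + j * (2 * h) + i = 0 + j * (2 * h) + (h + i) := by ring
  rcases lt_or_ge (i + 1) (2 * h) with hi2 | hi2
  · rw [blockCycles_apply_of_lt hN j hi2]
    rcases lt_trichotomy (i + 1) h with hih | hih | hih
    · left
      rw [e1, blockCycles_apply_of_lt hN j (by omega)]
    · right; left
      refine ⟨j, congrArg _ ?_, ?_⟩
      · rw [Nat.add_one_mul j (2 * h)]; omega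
      · rw [e1, blockCycles_apply_last hN j (by omega), zero_add]
    · left
      have e2 : h + j * (2 * h) + i = 0 + (j + 1) * (2 * h) + (i - h) := by
        rw [Nat.add_one_mul j (2 * h)]; omega
      rw [e2, blockCycles_apply_of_lt hN (j + 1) (by omega)]
  · right; right
    refine ⟨j, blockCycles_apply_last hN j (by omega), ?_⟩
    have e2 : h + j * (2 * h) + i = 0 + (j + 1) * (2 * h) + (h - 1) := by
      rw [Nat.add_one_mul j (2 * h)]; omega
    rw [e2, blockCycles_apply_of_lt hN (j + 1) (by omega)]
    congr 1
    omega

/-- At the last point of an unshifted block the hypothesis links consecutive even multiples of `h`;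
at the last point of a shifted block it links consecutive odd ones. -/
theorem apply_collapse {β : Type*} (hN : n * (2 * h) = N) {φ : Fin N → β}
    (hφ : ∀ z, φ (blockCycles N h (2 * h) n z) = φ (blockCycles N 0 (2 * h) n z)) (x : Fin N) :
    φ (collapse N h x) = φ x := by
  have hL : 0 < 2 * h := Nat.pos_of_mul_pos_left (hN ▸ NeZero.pos N)
  have h0 : ∀ j, φ (Fin.ofNat N (j * (2 * h))) = φ (Fin.ofNat N 0) := by
    intro j
    induction j with
    | zero => rw [zero_mul]
    | succ j ih =>
      have e := hφ (Fin.ofNat N (0 + j * (2 * h) + (2 * h - 1)))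
      rw [blockCycles_apply_last hN j (by omega)] at e
      have e' : 0 + j * (2 * h) + (2 * h - 1) = h + j * (2 * h) + (h - 1) := by omega
      rw [e', blockCycles_apply_of_lt hN j (by omega), zero_add, ih] at e
      rw [← e, Nat.add_one_mul j (2 * h)]
      congr 2
      omega
  have h1 : ∀ j, φ (Fin.ofNat N (h + j * (2 * h))) = φ (Fin.ofNat N h) := by
    intro j
    induction j with
    | zero => rw [zero_mul, add_zero]
    | succ j ih =>
      have e := hφ (Fin.ofNat N (h + j * (2 * h) + (2 * h - 1)))
      rw [blockCycles_apply_last hN j (by omega)] at e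
      have e' : h + j * (2 * h) + (2 * h - 1) = 0 + (j + 1) * (2 * h) + (h - 1) := by
        rw [Nat.add_one_mul j (2 * h)]; omega
      rw [e', blockCycles_apply_of_lt hN (j + 1) (by omega), ih] at e
      rw [e]
      congr 2
      omega
  unfold collapse
  split_ifs with hx hx'
  · obtain ⟨j, hj⟩ := hx
    rw [← h0 j, mul_comm, ← hj, ofNat_val]
  · obtain ⟨q, hq⟩ := hx'
    obtain ⟨j, rfl | rfl⟩ := q.even_or_odd'
    · exact absurd ⟨j, by rw [hq]; ring⟩ hx
    · rw [← h1 j, ← ofNat_val x, hq]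
      congr 2
      ring
  · rfl

theorem card_image_collapse_le (hN : n * (2 * h) = N) :
    (Finset.univ.image (collapse N h)).card + 2 * n ≤ N + 2 := by
  have hU := card_filter_dvd_val (N := N) (d := h) (k := 2 * n) (by rw [← hN]; ring)
  have hsub : Finset.univ.image (collapse N h) ⊆
      insert (Fin.ofNat N 0) (insert (Fin.ofNat N h)
        (Finset.univ.filter fun x : Fin N => ¬ h ∣ x.val)) := by
    intro y hy
    obtain ⟨x, -, rfl⟩ := Finset.mem_image.mp hy
    unfold collapse
    split_ifs with h0 h1
    · simp
    · simp
    · simp [h1]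
  have h1 := Finset.card_le_card hsub
  have h2 := Finset.card_insert_le (Fin.ofNat N 0) (insert (Fin.ofNat N h)
        (Finset.univ.filter fun x : Fin N => ¬ h ∣ x.val))
  have h3 := Finset.card_insert_le (Fin.ofNat N h)
        (Finset.univ.filter fun x : Fin N => ¬ h ∣ x.val)
  have h4 := Finset.card_filter_add_card_filter_not (s := Finset.univ) fun x : Fin N => h ∣ x.val
  rw [Finset.card_univ, Fintype.card_fin] at h4
  omega

/-- `B * A⁻¹` moves only multiples of `h` and preserves the even ones, so it acts on two invariant
sets of size `n`, costing at most `n - 1` each. -/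
theorem cayleyDist_blockCycles_shift_add_two_le (hN : n * (2 * h) = N) :
    cayleyDist (blockCycles N h (2 * h) n) (blockCycles N 0 (2 * h) n) + 2 ≤ 2 * n := by
  have hh : 0 < h := by
    have := Nat.pos_of_mul_pos_left (hN ▸ NeZero.pos N); omega
  have hdN : 2 * h ∣ N := ⟨n, by rw [← hN, mul_comm]⟩
  have hdN' : h ∣ N := (dvd_mul_left h 2).trans hdN
  set A := blockCycles N h (2 * h) n
  set B := blockCycles N 0 (2 * h) n
  set U := Finset.univ.filter fun x : Fin N => h ∣ x.val with hU
  set T := Finset.univ.filter fun x : Fin N => 2 * h ∣ x.val with hT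
  have hcU : U.card = 2 * n := card_filter_dvd_val (by rw [← hN]; ring)
  have hcT : T.card = n := card_filter_dvd_val hN
  have hTU : T ⊆ U := fun x hx => by
    simp only [hT, hU, Finset.mem_filter, Finset.mem_univ, true_and] at hx ⊢
    exact (dvd_mul_left h 2).trans hx
  have hcS := Finset.card_sdiff_add_card_eq_card hTU
  have key := cayleyDist_one_add_two_le_card T (U \ T) ⟨Fin.ofNat N 0, by simp [hT, Fin.ofNat]⟩
    ⟨Fin.ofNat N h, by
      simp only [hT, hU, Finset.mem_sdiff, Finset.mem_filter, Finset.mem_univ, true_and,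
        dvd_val_ofNat_iff hdN, dvd_val_ofNat_iff hdN']
      exact ⟨dvd_rfl, not_two_mul_dvd_self hh⟩⟩ (B * A⁻¹)
    (fun x hx => by
      obtain ⟨z, rfl⟩ := A.surjective x
      rw [← Equiv.Perm.mul_apply, inv_mul_cancel_right]
      simp only [hT, Finset.mem_filter, Finset.mem_univ, true_and] at hx ⊢
      rcases blockCycles_shift_cases hN z with e | ⟨j, -, e⟩ | ⟨j, e, -⟩
      · exact e ▸ hx
      · rw [show B z = _ from e, dvd_val_ofNat_iff hdN]
        exact dvd_mul_left _ _
      · rw [show A z = _ from e, dvd_val_ofNat_iff hdN,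
          Nat.dvd_add_left (dvd_mul_left _ _)] at hx
        exact absurd hx (not_two_mul_dvd_self hh))
    (fun x hxT hxS => by
      have hxU : x ∉ U := fun hxU => hxS (Finset.mem_sdiff.mpr ⟨hxU, hxT⟩)
      obtain ⟨z, rfl⟩ := A.surjective x
      rw [← Equiv.Perm.mul_apply, inv_mul_cancel_right]
      simp only [hU, Finset.mem_filter, Finset.mem_univ, true_and] at hxU
      rcases blockCycles_shift_cases hN z with e | ⟨j, e, -⟩ | ⟨j, e, -⟩
      · exact e.symm
      · rw [show A z = _ from e, dvd_val_ofNat_iff hdN'] at hxU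
        exact absurd ((dvd_mul_left h 2).trans (dvd_mul_left _ _)) hxU
      · rw [show A z = _ from e, dvd_val_ofNat_iff hdN'] at hxU
        exact absurd (dvd_add dvd_rfl ((dvd_mul_left h 2).trans (dvd_mul_left _ _))) hxU)
  have hr := cayleyDist_mul_right_le 1 (B * A⁻¹) A
  rw [one_mul, inv_mul_cancel_right] at hr
  omega

/-- A colouring invariant under both factorisations, from `g` to `A` and from `g` to `B`, identifies
`A z`, `g z` and `B z`, hence factors through `collapse`, which has at most `N - 2n + 2` values.
Counting colours gives the bound; equality makes the colouring injective on those values. -/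
theorem collapse_eq_of_cayleyDist_add_le (hN : n * (2 * h) = N) (g : Equiv.Perm (Fin N)) :
    2 * n ≤ cayleyDist g (blockCycles N h (2 * h) n) +
        cayleyDist g (blockCycles N 0 (2 * h) n) + 2 ∧
      (cayleyDist g (blockCycles N h (2 * h) n) +
        cayleyDist g (blockCycles N 0 (2 * h) n) + 2 ≤ 2 * n →
      ∀ z, collapse N h (g z) = collapse N h (blockCycles N h (2 * h) n z)) := by
  set A := blockCycles N h (2 * h) n
  set B := blockCycles N 0 (2 * h) n
  obtain ⟨l, hlen, hl, hp⟩ := exists_list_length_eq_cayleyDist g A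
  obtain ⟨l', hlen', hl', hp'⟩ := exists_list_length_eq_cayleyDist g B
  obtain ⟨φ, hφ, hc⟩ := exists_invariant_colouring (l ++ l') fun σ hσ =>
    (List.mem_append.mp hσ).elim (hl σ) (hl' σ)
  have hA : ∀ z, φ (A z) = φ (g z) := fun z => by
    rw [← hp, Equiv.Perm.mul_apply]
    exact apply_prod_eq (fun σ hσ => hφ σ (by simp [hσ])) _
  have hB : ∀ z, φ (B z) = φ (g z) := fun z => by
    rw [← hp', Equiv.Perm.mul_apply]
    exact apply_prod_eq (fun σ hσ => hφ σ (by simp [hσ])) _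
  have hcol : ∀ x, φ (collapse N h x) = φ x :=
    apply_collapse hN fun z => (hA z).trans (hB z).symm
  have himg : (Finset.univ.image (collapse N h)).image φ = Finset.univ.image φ := by
    rw [Finset.image_image]
    exact Finset.image_congr fun x _ => hcol x
  have h1 := card_image_collapse_le hN
  have h2 : ((Finset.univ.image (collapse N h)).image φ).card ≤ _ := Finset.card_image_le
  rw [← himg, Fintype.card_fin, List.length_append, hlen, hlen'] at hc
  refine ⟨by omega, fun hle z => ?_⟩
  have hinj := Finset.card_image_iff.mp
    (show ((Finset.univ.image (collapse N h)).image φ).card = _ by omega)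
  exact hinj (by simp) (by simp) (by rw [hcol, hcol, hA])

/-- A permutation on a geodesic between the two families of blocks has at most `n` cycles. -/
theorem card_le_of_collapse_eq (hN : n * (2 * h) = N) {g : Equiv.Perm (Fin N)}
    (hg : ∀ z, collapse N h (g z) = collapse N h (blockCycles N h (2 * h) n z)) :
    N ≤ n + cayleyDist g 1 := by
  have hL : 0 < 2 * h := Nat.pos_of_mul_pos_left (hN ▸ NeZero.pos N)
  have hdN : 2 * h ∣ N := ⟨n, by rw [← hN, mul_comm]⟩
  have hdN' : h ∣ N := (dvd_mul_left h 2).trans hdN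
  have hn : 0 < n := Nat.pos_of_mul_pos_right (hN ▸ NeZero.pos N)
  set A := blockCycles N h (2 * h) n with hA
  -- First half of a shifted block: `g` follows `A` up to the half's last point, then lands on some
  -- even multiple of `h`. The induction runs backwards from that last point.
  have odd : ∀ j i, i < h → ∃ t : Fin N, 2 * h ∣ t.val ∧
      g.SameCycle (Fin.ofNat N (h + j * (2 * h) + (h - 1 - i))) t := by
    intro j i hi
    induction i with
    | zero =>
      refine ⟨g (Fin.ofNat N (h + j * (2 * h) + (h - 1 - 0))), ?_,
        Equiv.Perm.sameCycle_apply_right.mpr (Equiv.Perm.SameCycle.refl _ _)⟩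
      rw [(collapse_eq_iff hN (hg _)).2.1, hA, blockCycles_apply_of_lt hN j (by omega),
        dvd_val_ofNat_iff hdN]
      exact ⟨j + 1, by rw [Nat.mul_succ, mul_comm]; omega⟩
    | succ i ih =>
      obtain ⟨t, ht, hs⟩ := ih (by omega)
      have hAz : A (Fin.ofNat N (h + j * (2 * h) + (h - 1 - (i + 1)))) =
          Fin.ofNat N (h + j * (2 * h) + (h - 1 - i)) := by
        rw [hA, blockCycles_apply_of_lt hN j (by omega)]
        congr 1
        omega
      have hgz := (collapse_eq_iff hN (hg _)).2.2 (by
        rw [hAz, dvd_val_ofNat_iff hdN', Nat.dvd_add_right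
          (dvd_add dvd_rfl ((dvd_mul_left h 2).trans (dvd_mul_left _ _)))]
        exact Nat.not_dvd_of_pos_of_lt (by omega) (by omega))
      rw [hAz] at hgz
      rw [← hgz] at hs
      exact ⟨t, ht, Equiv.Perm.sameCycle_apply_left.mp hs⟩
  -- Second half: `g` follows `A` to the end of the block, then lands on some odd multiple of `h`,
  -- which starts a first half treated by `odd`.
  have even : ∀ j i, i < h → ∃ t : Fin N, 2 * h ∣ t.val ∧
      g.SameCycle (Fin.ofNat N (h + j * (2 * h) + (2 * h - 1 - i))) t := by
    intro j i hi
    induction i with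
    | zero =>
      set z := Fin.ofNat N (h + j * (2 * h) + (2 * h - 1 - 0)) with hz
      have hAz : A z = Fin.ofNat N (h + j * (2 * h)) := by
        rw [hA, hz, blockCycles_apply_last hN j (by omega)]
      have h1 := (collapse_eq_iff hN (hg z)).1
      have h2 := (collapse_eq_iff hN (hg z)).2.1
      rw [hAz, dvd_val_ofNat_iff hdN'] at h1
      rw [hAz, dvd_val_ofNat_iff hdN, Nat.dvd_add_left (dvd_mul_left _ _)] at h2
      obtain ⟨q, hq⟩ := h1.mpr (dvd_add dvd_rfl ((dvd_mul_left h 2).trans (dvd_mul_left _ _)))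
      obtain ⟨p, rfl | rfl⟩ := q.even_or_odd'
      · exact absurd (h2.mp ⟨p, by rw [hq]; ring⟩) (not_two_mul_dvd_self (by omega))
      · obtain ⟨t, ht, hs⟩ := odd p (h - 1) (by omega)
        refine ⟨t, ht, Equiv.Perm.sameCycle_apply_left.mp ?_⟩
        have e : g z = Fin.ofNat N (h + p * (2 * h) + (h - 1 - (h - 1))) := by
          rw [← ofNat_val (g z), hq, Nat.sub_self, add_zero]
          congr 1
          ring
        rw [e]
        exact hs
    | succ i ih =>
      obtain ⟨t, ht, hs⟩ := ih (by omega)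
      have hAz : A (Fin.ofNat N (h + j * (2 * h) + (2 * h - 1 - (i + 1)))) =
          Fin.ofNat N (h + j * (2 * h) + (2 * h - 1 - i)) := by
        rw [hA, blockCycles_apply_of_lt hN j (by omega)]
        congr 1
        omega
      have hgz := (collapse_eq_iff hN (hg _)).2.2 (by
        have e : h + j * (2 * h) + (2 * h - 1 - i) = (2 * j + 2) * h + (h - 1 - i) := by
          have : (2 * j + 2) * h = j * (2 * h) + 2 * h := by ring
          omega
        rw [hAz, dvd_val_ofNat_iff hdN', e, Nat.dvd_add_right (dvd_mul_left _ _)]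
        exact Nat.not_dvd_of_pos_of_lt (by omega) (by omega))
      rw [hAz] at hgz
      rw [← hgz] at hs
      exact ⟨t, ht, Equiv.Perm.sameCycle_apply_left.mp hs⟩
  have key := card_le_card_add_cayleyDist_one g
    (Finset.univ.filter fun x : Fin N => 2 * h ∣ x.val) fun x => by
      have hhN : h ≤ N := by
        have := Nat.le_mul_of_pos_left (2 * h) hn; omega
      obtain ⟨j, i, hi, rfl, -⟩ := exists_ofNat_eq hhN hL x
      simp only [Finset.mem_filter, Finset.mem_univ, true_and]
      rcases lt_or_ge i h with hih | hih
      · have := odd j (h - 1 - i) (by omega)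
        rwa [show h - 1 - (h - 1 - i) = i by omega] at this
      · have := even j (2 * h - 1 - i) (by omega)
        rwa [show 2 * h - 1 - (2 * h - 1 - i) = i by omega] at this
  rwa [card_filter_dvd_val hN, Fintype.card_fin] at key

/-- Since `d(A, B) = 2n - 2` is even, so is `a + b`; hence failing to be at most `2n - 2` means
being at least `2n`. -/
theorem le_cayleyDist_add_of_shift (hN : n * (2 * h) = N) (g : Equiv.Perm (Fin N)) :
    2 * n ≤ cayleyDist g (blockCycles N h (2 * h) n) + cayleyDist g (blockCycles N 0 (2 * h) n) ∨
      2 * n ≤ cayleyDist g (blockCycles N h (2 * h) n) +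
        cayleyDist g (blockCycles N 0 (2 * h) n) + 2 ∧ N ≤ n + cayleyDist g 1 := by
  have h1 := collapse_eq_of_cayleyDist_add_le hN g
  have h2 := (collapse_eq_of_cayleyDist_add_le hN (blockCycles N h (2 * h) n)).1
  rw [cayleyDist_self] at h2
  have h3 := cayleyDist_blockCycles_shift_add_two_le hN
  obtain ⟨r, hr⟩ := even_cayleyDist_add_add (blockCycles N h (2 * h) n) g
    (blockCycles N 0 (2 * h) n)
  rw [cayleyDist_comm _ g] at hr
  by_cases hle : cayleyDist g (blockCycles N h (2 * h) n) +
      cayleyDist g (blockCycles N 0 (2 * h) n) + 2 ≤ 2 * n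
  · exact Or.inr ⟨h1.1, card_le_of_collapse_eq hN (h1.2 hle)⟩
  · left
    omega

end Geodesic


/-! ### Arithmetic of block indices. -/

/-- The `2n` half blocks form a cyclic row, and the two families of blocks pair neighbours in the
two alternate ways. Distinct half blocks cannot be paired both ways unless `n = 1`, where the
pairings coincide. -/
theorem half_block_eq_iff {n h u v : ℕ} (hn : 2 ≤ n) (hu : u < 2 * h * n) (hv : v < 2 * h * n) :
    u / h = v / h ↔ (u + (2 * h * n - h)) % (2 * h * n) / (2 * h) =
      (v + (2 * h * n - h)) % (2 * h * n) / (2 * h) ∧ u / (2 * h) = v / (2 * h) := by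
  have hh : 0 < h := by
    rcases Nat.eq_zero_or_pos h with rfl | hh
    · simp at hu
    · exact hh
  have key : ∀ {w}, w < 2 * h * n → (w + (2 * h * n - h)) % (2 * h * n) / (2 * h) =
      (w / h + (2 * n - 1)) % (2 * n) / 2 ∧ w / (2 * h) = w / h / 2 ∧ w / h < 2 * n := by
    intro w hw
    have e1 : w + (2 * h * n - h) = w + h * (2 * n - 1) := by
      rw [Nat.mul_sub, mul_one]
      congr 2
      ring
    have e2 : 2 * h * n = h * (2 * n) := by ring
    refine ⟨?_, by rw [mul_comm, Nat.div_div_eq_div_mul], ?_⟩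
    · rw [e1, e2, mul_comm 2 h, ← Nat.div_div_eq_div_mul, Nat.mod_mul_right_div_self,
        Nat.add_mul_div_left _ _ hh]
    · rw [Nat.div_lt_iff_lt_mul hh]
      linarith
  obtain ⟨u1, u2, u3⟩ := key hu
  obtain ⟨v1, v2, v3⟩ := key hv
  rw [u1, u2, v1, v2]
  generalize u / h = p at *
  generalize v / h = q at *
  have hmod : ∀ {p}, p < 2 * n → (p + (2 * n - 1)) % (2 * n) =
      if p = 0 then 2 * n - 1 else p - 1 := by
    intro p hp
    split_ifs with h0
    · rw [h0, zero_add, Nat.mod_eq_of_lt (by omega)]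
    · have : p + (2 * n - 1) = p - 1 + 2 * n := by omega
      rw [this, Nat.add_mod_right, Nat.mod_eq_of_lt (by omega)]
  rw [hmod u3, hmod v3]
  split_ifs <;> omega

/-! ### Assembly: the free energy bound and the partition identity. -/

section Main

variable (m n : ℕ) [NeZero m] [NeZero n]

theorem gB_eq_blockCycles : gB m n = blockCycles (m * n) 0 m n := by
  simp [gB, blockCycles]

theorem gA_eq_blockCycles : gA m n = blockCycles (m * n) (m / 2) m n := by
  simp [gA, blockCycles, add_comm]

theorem gX_eq_blockCycles : gX m n = blockCycles (m * n) 0 (m / 2) (2 * n) := by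
  simp [gX, blockCycles]

variable {m n}

theorem exists_freeEnergy_le (hm : Even m) {x y : ℝ} (hx : 0 < x) (hy : 0 < y)
    (g : Equiv.Perm (Fin (m * n))) :
    freeEnergy m n x y 1 ≤ freeEnergy m n x y g ∨
      freeEnergy m n x y (gX m n) ≤ freeEnergy m n x y g ∨
      freeEnergy m n x y (gA m n) ≤ freeEnergy m n x y g ∨
      freeEnergy m n x y (gB m n) ≤ freeEnergy m n x y g := by
  have hm0 : 0 < m := NeZero.pos m
  have hn0 : 0 < n := NeZero.pos n
  obtain ⟨h, rfl⟩ := hm.two_dvd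
  have hh : 0 < h := by omega
  have hN : n * (2 * h) = 2 * h * n := mul_comm _ _
  have hN2 : 2 * n * h = 2 * h * n := by ring
  have hhN : h ≤ 2 * h * n := by nlinarith
  have hdiv : 2 * h / 2 = h := by omega
  simp only [freeEnergy, gA_eq_blockCycles, gB_eq_blockCycles, gX_eq_blockCycles, hdiv]
  have hAX := cayleyDist_blockCycles_two_mul_le (N := 2 * h * n) h n hh
  rw [blockCycles_self_add hN2] at hAX
  have hBX := cayleyDist_blockCycles_two_mul_le (N := 2 * h * n) 0 n hh
  have hX := cayleyDist_blockCycles_one_le (N := 2 * h * n) 0 h (2 * n)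
  have hA := cayleyDist_blockCycles_one_le (N := 2 * h * n) h (2 * h) n
  have hB := cayleyDist_blockCycles_one_le (N := 2 * h * n) 0 (2 * h) n
  have hA' := card_le_add_cayleyDist_blockCycles_one hN hhN
  have hB' := card_le_add_cayleyDist_blockCycles_one hN (Nat.zero_le _)
  have hAB := cayleyDist_blockCycles_shift_add_two_le hN
  have hdich := le_cayleyDist_add_of_shift hN g
  set A := blockCycles (2 * h * n) h (2 * h) n
  set B := blockCycles (2 * h * n) 0 (2 * h) n
  set X := blockCycles (2 * h * n) 0 h (2 * n)
  have hac := cayleyDist_triangle A g 1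
  have hbc := cayleyDist_triangle B g 1
  have hab := cayleyDist_triangle g B A
  rw [cayleyDist_comm A g] at hac
  rw [cayleyDist_comm B g] at hbc
  rw [cayleyDist_comm B A] at hab
  rw [cayleyDist_self, cayleyDist_self, cayleyDist_self, cayleyDist_comm 1 A, cayleyDist_comm 1 B,
    cayleyDist_comm B A]
  generalize cayleyDist g A = a at *
  generalize cayleyDist g B = b at *
  generalize cayleyDist g 1 = c at *
  generalize cayleyDist A B = dAB at *
  generalize cayleyDist X A = dXA at *
  generalize cayleyDist X B = dXB at *
  generalize cayleyDist X 1 = dX at *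
  generalize cayleyDist A 1 = dA at *
  generalize cayleyDist B 1 = dB at *
  obtain ⟨K, hK⟩ : ∃ K, K + n = 2 * h * n :=
    ⟨2 * h * n - n, Nat.sub_add_cancel (Nat.le_mul_of_pos_left n hm0)⟩
  have hX2 : dX + n ≤ K := by
    rw [Nat.mul_sub, mul_one, hN2] at hX
    have : 2 * n ≤ 2 * h * n := by nlinarith
    omega
  have hKA : dA = K := by
    rw [Nat.mul_sub, mul_one, hN] at hA
    omega
  have hKB : dB = K := by
    rw [Nat.mul_sub, mul_one, hN] at hB
    omega
  have hacK : (K : ℝ) ≤ a + c := by exact_mod_cast (by omega : K ≤ a + c)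
  have hbcK : (K : ℝ) ≤ b + c := by exact_mod_cast (by omega : K ≤ b + c)
  have hABr : (dAB : ℝ) ≤ 2 * n - 2 := by
    have : ((dAB + 2 : ℕ) : ℝ) ≤ (2 * n : ℕ) := by exact_mod_cast hAB
    push_cast at this
    linarith
  subst hKA hKB
  have hXr : (dX : ℝ) ≤ dB - n := by
    have : ((dX + n : ℕ) : ℝ) ≤ dB := by exact_mod_cast hX2
    push_cast at this
    linarith
  have hXAr : (dXA : ℝ) ≤ n := by exact_mod_cast hAX
  have hXBr : (dXB : ℝ) ≤ n := by exact_mod_cast hBX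
  have ha0 : (0 : ℝ) ≤ a := Nat.cast_nonneg _
  have hb0 : (0 : ℝ) ≤ b := Nat.cast_nonneg _
  have hc0 : (0 : ℝ) ≤ c := Nat.cast_nonneg _
  push_cast
  rcases Nat.lt_or_ge n 2 with hn | hn
  -- Here `d(A, B) = 0`, so `a ≤ b` by the triangle inequality; `e` is optimal when `x + y ≤ 1` and
  -- `g_A` otherwise.
  · obtain rfl : n = 1 := by omega
    have hd0 : dAB = 0 := by omega
    subst hd0
    have hba : a ≤ b := by omega
    have hbar : (a : ℝ) ≤ b := by exact_mod_cast hba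
    rcases le_total (x + y) 1 with hxy | hxy
    · left
      nlinarith [mul_le_mul_of_nonneg_left hacK hx.le, mul_le_mul_of_nonneg_left hbcK hy.le,
        mul_nonneg (by linarith : 0 ≤ 1 - x - y) hc0]
    · right; right; left
      push_cast
      nlinarith [mul_le_mul_of_nonneg_left hbar hy.le,
        mul_nonneg (by linarith : 0 ≤ x + y - 1) ha0]
  · have hnr : (2 : ℝ) ≤ n := by exact_mod_cast hn
    have hABd : (2 * n - 2 : ℝ) ≤ a + b ∧
        (2 * n * (n - 1) + 2 * dB : ℝ) ≤ n * (a + b) + 2 * c := by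
      rcases hdich with hd | ⟨hd, hc⟩
      · have hd' : (2 * n : ℝ) ≤ a + b := by exact_mod_cast hd
        refine ⟨by linarith, ?_⟩
        linarith [mul_le_mul_of_nonneg_left hd' (by linarith : (0 : ℝ) ≤ n - 1)]
      · have hd' : (2 * n : ℝ) ≤ a + b + 2 := by exact_mod_cast hd
        have hc' : (dB : ℝ) ≤ c := by exact_mod_cast (by omega : dB ≤ c)
        refine ⟨by linarith, ?_⟩
        linarith [mul_le_mul_of_nonneg_left hd' (by linarith : (0 : ℝ) ≤ n)]
    rcases exists_vertex_le hnr hx hy ha0 hb0 hc0 hacK hbcK hABd.1 hABd.2 with h1 | h1 | h1 | h1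
    · left; linarith
    · right; left
      linarith [mul_le_mul_of_nonneg_left hXAr hx.le, mul_le_mul_of_nonneg_left hXBr hy.le]
    · right; right; left
      linarith [mul_le_mul_of_nonneg_left hABr hy.le]
    · right; right; right
      linarith [mul_le_mul_of_nonneg_left hABr hx.le]

theorem cyclePartition_gX (hm : Even m) (hn : 2 ≤ n) :
    cyclePartition (gX m n) = cyclePartition (gA m n) ⊓ cyclePartition (gB m n) := by
  obtain ⟨h, rfl⟩ := hm.two_dvd
  have hm0 : 0 < 2 * h := NeZero.pos _
  have hdiv : 2 * h / 2 = h := by omega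
  have hhN : h ≤ 2 * h * n := by nlinarith
  ext u v
  change (gX (2 * h) n).SameCycle u v ↔
    (gA (2 * h) n).SameCycle u v ∧ (gB (2 * h) n).SameCycle u v
  rw [gA_eq_blockCycles, gB_eq_blockCycles, gX_eq_blockCycles, hdiv,
    sameCycle_blockCycles_iff (by ring) (Nat.zero_le _),
    sameCycle_blockCycles_iff (mul_comm _ _) hhN,
    sameCycle_blockCycles_iff (mul_comm _ _) (Nat.zero_le _)]
  simp only [Nat.sub_zero, Nat.add_mod_right, Nat.mod_eq_of_lt u.isLt, Nat.mod_eq_of_lt v.isLt]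
  exact half_block_eq_iff hn u.isLt v.isLt

end Main

end ReflectedEntropy

theorem mainTheorem1 (m n : ℕ) [NeZero m] [NeZero n] (hm : Even m) :
    (∀ xA xB : ℝ, 0 < xA → 0 < xB →
      Finset.univ.inf' Finset.univ_nonempty (ReflectedEntropy.freeEnergy m n xA xB) =
        ({1, ReflectedEntropy.gX m n, ReflectedEntropy.gA m n, ReflectedEntropy.gB m n} :
          Finset (Equiv.Perm (Fin (m * n)))).inf' (Finset.insert_nonempty _ _)
          (ReflectedEntropy.freeEnergy m n xA xB)) ∧
    (2 ≤ n →
      ReflectedEntropy.cyclePartition (ReflectedEntropy.gX m n) =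
        ReflectedEntropy.cyclePartition (ReflectedEntropy.gA m n) ⊓
          ReflectedEntropy.cyclePartition (ReflectedEntropy.gB m n)) := by
  refine ⟨fun xA xB hA hB => le_antisymm ?_ ?_, ReflectedEntropy.cyclePartition_gX hm⟩
  · exact Finset.inf'_mono _ (Finset.subset_univ _) _
  · refine Finset.le_inf' _ _ fun g _ => ?_
    rcases ReflectedEntropy.exists_freeEnergy_le hm hA hB g with h | h | h | h
    all_goals exact (Finset.inf'_le _ (by simp)).trans h
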